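/- Let $g,t$ be positive integers and let $K$ be a set of positive integers. A $(gt,g,K,1)$-cyclic difference family is a family $\mathscr F$ of subsets (base blocks) of $\mathbb Z_{gt}=\mathbb Z/gt\mathbb Z$ such that (1) $|B|\in K$ for every $B\in\mathscr F$; and (2) the differences $x-y$, where $(x,y)$ runs over the ordered pairs of distinct elements of $B$ and $B$ runs over $\mathscr F$, taken with multiplicity, cover each element of $\mathbb Z_{gt}\setminus\{0,t,2t,\ldots,(g-1)t\}$ exactly once and cover no element of $\{0,t,2t,\ldots,(g-1)t\}$. **Lemma.** For every odd integer $t\ge 7$ with $t\ne 11$ there exists a $(4t,4,\{3,5\},1)$-cyclic difference family. -/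

import Mathlib

/-- The list (with multiplicity) `ΔB` of the differences `x - y` of ordered pairs of distinct
elements `x, y` of a finite subset `B` of `ℤ/v`. -/
def differenceList {v : ℕ} (B : Finset (ZMod v)) : Multiset (ZMod v) :=
  B.offDiag.val.map fun p => p.1 - p.2

/-- `𝓕` is the family of base blocks of a `(gt, g, K, 1)`-cyclic difference family, for positive
integers `g` and `t`: every base block is a subset of `ℤ/gt` whose size lies in `K`, and the
differences of the base blocks, taken together and with multiplicity, cover each element of
`ℤ/gt` outside `{0, t, 2t, …, (g-1)t}` exactly once and no element of `{0, t, 2t, …, (g-1)t}`. -/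
structure IsCyclicDifferenceFamily (g t : ℕ) (K : Set ℕ)
    (𝓕 : Multiset (Finset (ZMod (g * t)))) : Prop where
  card_mem : ∀ B ∈ 𝓕, B.card ∈ K
  count_eq_one : ∀ d : ZMod (g * t), (¬ ∃ i : ℕ, i < g ∧ d = ((i * t : ℕ) : ZMod (g * t))) →
    (𝓕.bind differenceList).count d = 1
  count_eq_zero : ∀ d : ZMod (g * t), (∃ i : ℕ, i < g ∧ d = ((i * t : ℕ) : ZMod (g * t))) →
    (𝓕.bind differenceList).count d = 0

/-!
The complement of `{0, t, 2t, 3t}` has `4t - 4` elements, so a family with at most `4t - 4`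
differences that covers this complement covers every element of it once and nothing else. Hence only
covering has to be checked, and by symmetry only for the residues `x` with `0 < x < 2t` and `x ≠ t`.

The triples `{0, 2i + r, s + i}` yield `2i + r` and the two values `s + i` and `s - r - i`; as `i`
runs through an interval, the former fill up a parity class and the latter two intervals facing
each other. Taking `r = 0`, `s = t` for the even differences and `r = 1`, `s ≈ 5t / 3` for the odd
ones covers everything when `t ≡ 1 (mod 6)`. When `t ≡ 3` or `5 (mod 6)` the count `4t - 4` is not
a multiple of `6`; one or two blocks of size five correct it, and with a few more triples they
absorb the differences left over at the ends of the intervals. The case `t = 9` is too small for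
this pattern and has a family of its own.
-/

section Criterion

variable {g t v : ℕ}

theorem mem_differenceList {B : Finset (ZMod v)} {d : ZMod v} :
    d ∈ differenceList B ↔ ∃ a ∈ B, ∃ b ∈ B, a ≠ b ∧ a - b = d := by
  simp [differenceList, and_assoc]

theorem neg_mem_differenceList {B : Finset (ZMod v)} {d : ZMod v} (hd : d ∈ differenceList B) :
    -d ∈ differenceList B := by
  obtain ⟨a, ha, b, hb, hab, rfl⟩ := mem_differenceList.1 hd
  exact mem_differenceList.2 ⟨b, hb, a, ha, hab.symm, (neg_sub a b).symm⟩

theorem neg_mem_bind_differenceList {𝓕 : Multiset (Finset (ZMod v))} {d : ZMod v}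
    (hd : d ∈ 𝓕.bind differenceList) : -d ∈ 𝓕.bind differenceList := by
  obtain ⟨B, hB, hdB⟩ := Multiset.mem_bind.1 hd
  exact Multiset.mem_bind.2 ⟨B, hB, neg_mem_differenceList hdB⟩

theorem card_differenceList (B : Finset (ZMod v)) :
    (differenceList B).card = B.card * (B.card - 1) := by
  rw [differenceList, Multiset.card_map, Finset.card_val, Finset.offDiag_card, Nat.mul_sub_one]

theorem addOrderOf_natCast_zmod_mul (ht : 0 < t) : addOrderOf (t : ZMod (g * t)) = g := by
  rw [ZMod.addOrderOf_coe' _ ht.ne', Nat.gcd_mul_left_left, Nat.mul_div_cancel _ ht]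

theorem exists_lt_eq_natCast_mul_iff_mem_zmultiples (hg : 0 < g) (ht : 0 < t) {d : ZMod (g * t)} :
    (∃ i : ℕ, i < g ∧ d = ((i * t : ℕ) : ZMod (g * t))) ↔
      d ∈ AddSubgroup.zmultiples (t : ZMod (g * t)) := by
  have : NeZero (g * t) := ⟨by positivity⟩
  rw [mem_zmultiples_iff_mem_range_addOrderOf, addOrderOf_natCast_zmod_mul ht]
  simp [eq_comm]

theorem isCyclicDifferenceFamily_of_covers (hg : 0 < g) {K : Set ℕ}
    {𝓕 : Multiset (Finset (ZMod (g * t)))} (hK : ∀ B ∈ 𝓕, B.card ∈ K)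
    (hcard : (𝓕.map fun B => B.card * (B.card - 1)).sum + g ≤ g * t)
    (hcov : ∀ d ∉ AddSubgroup.zmultiples (t : ZMod (g * t)), d ∈ 𝓕.bind differenceList) :
    IsCyclicDifferenceFamily g t K 𝓕 := by
  classical
  have ht : 0 < t := pos_of_mul_pos_right (show 0 < g * t by omega) g.zero_le
  have : NeZero (g * t) := ⟨by positivity⟩
  let C : Finset (ZMod (g * t)) :=
    ({d | d ∈ AddSubgroup.zmultiples (t : ZMod (g * t))} : Finset (ZMod (g * t)))ᶜ
  have mem_C (d) : d ∈ C ↔ d ∉ AddSubgroup.zmultiples (t : ZMod (g * t)) := by simp [C]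
  have card_C : C.card = g * t - g := by
    rw [Finset.card_compl, ZMod.card, ← Fintype.card_subtype, ← Nat.card_eq_fintype_card]
    exact congrArg _ ((Nat.card_zmultiples _).trans (addOrderOf_natCast_zmod_mul ht))
  have card_bind :
      (𝓕.bind differenceList).card = (𝓕.map fun B => B.card * (B.card - 1)).sum := by
    simp only [Multiset.card_bind, Function.comp_def, card_differenceList]
  have C_le : C.val ≤ 𝓕.bind differenceList :=
    (Multiset.le_iff_subset C.nodup).2 fun d hd => hcov d ((mem_C d).1 hd)
  have C_eq : C.val = 𝓕.bind differenceList :=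
    Multiset.eq_of_le_of_card_le C_le (by rw [card_bind, Finset.card_val, card_C]; omega)
  refine ⟨hK, fun d hd => ?_, fun d hd => ?_⟩ <;>
    rw [exists_lt_eq_natCast_mul_iff_mem_zmultiples hg ht] at hd
  · rw [← C_eq, Multiset.count_eq_one_of_mem C.nodup ((mem_C d).2 hd)]
  · rw [← C_eq, Multiset.count_eq_zero]
    exact fun hdC => (mem_C d).1 hdC hd

end Criterion

section Representatives

variable {g t v : ℕ}

/-- The blocks of `𝓑`, read modulo `v`, have `x` as a difference. For elements and `x` in `[0, v)`
the two alternatives are the two ways in which `a - b` can be congruent to `x`; unlike a congruence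
they are linear in `v`. -/
def HasDifference (v : ℕ) (𝓑 : Multiset (Finset ℕ)) (x : ℕ) : Prop :=
  ∃ B ∈ 𝓑, ∃ a ∈ B, ∃ b ∈ B, b + x = a ∨ b + x = a + v

theorem hasDifference_add {𝓑 𝓒 : Multiset (Finset ℕ)} {x : ℕ} :
    HasDifference v (𝓑 + 𝓒) x ↔ HasDifference v 𝓑 x ∨ HasDifference v 𝓒 x := by
  simp only [HasDifference, Multiset.mem_add, or_and_right, exists_or]

theorem card_image_natCast_zmod {B : Finset ℕ} (hB : B ⊆ Finset.range v) :
    (B.image (Nat.cast : ℕ → ZMod v)).card = B.card := by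
  refine Finset.card_image_of_injOn fun a ha b hb hab => ?_
  exact Nat.ModEq.eq_of_lt_of_lt ((ZMod.natCast_eq_natCast_iff a b v).1 hab)
    (Finset.mem_range.1 (hB ha)) (Finset.mem_range.1 (hB hb))

theorem HasDifference.natCast_mem_bind_differenceList {𝓑 : Multiset (Finset ℕ)} {x : ℕ}
    (h : HasDifference v 𝓑 x) (hx : (x : ZMod v) ≠ 0) :
    (x : ZMod v) ∈ (𝓑.map (Finset.image Nat.cast)).bind differenceList := by
  obtain ⟨B, hB, a, ha, b, hb, hab⟩ := h
  have hsub : (a : ZMod v) - b = x := by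
    rw [sub_eq_iff_eq_add']
    rcases hab with rfl | hab
    · exact Nat.cast_add b x
    · simpa using (congrArg (Nat.cast : ℕ → ZMod v) hab).symm
  refine Multiset.mem_bind.2 ⟨_, Multiset.mem_map_of_mem _ hB, mem_differenceList.2
    ⟨a, Finset.mem_image_of_mem _ ha, b, Finset.mem_image_of_mem _ hb, fun hne => hx ?_, hsub⟩⟩
  rw [← hsub, hne, sub_self]

theorem exists_natCast_eq_or_neg_natCast_eq (hv : 0 < v) (d : ZMod v) :
    ∃ x : ℕ, 2 * x ≤ v ∧ (d = x ∨ d = -x) := by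
  have : NeZero v := ⟨hv.ne'⟩
  have hle := ZMod.natAbs_valMinAbs_le d
  refine ⟨d.valMinAbs.natAbs, by omega, ?_⟩
  have hd := ZMod.coe_valMinAbs d
  rcases Int.natAbs_eq d.valMinAbs with h | h
  · left
    rw [← Int.cast_natCast, ← h, hd]
  · right
    rw [← Int.cast_natCast, ← Int.cast_neg, ← h, hd]

theorem exists_isCyclicDifferenceFamily_of_hasDifference (hg : 0 < g) {K : Set ℕ}
    {𝓑 : Multiset (Finset ℕ)} (hlt : ∀ B ∈ 𝓑, B ⊆ Finset.range (g * t)) (hK : ∀ B ∈ 𝓑, B.card ∈ K)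
    (hcard : (𝓑.map fun B => B.card * (B.card - 1)).sum + g ≤ g * t)
    (hcov : ∀ x, 2 * x ≤ g * t → ¬ t ∣ x → HasDifference (g * t) 𝓑 x) :
    ∃ 𝓕 : Multiset (Finset (ZMod (g * t))), IsCyclicDifferenceFamily g t K 𝓕 := by
  refine ⟨𝓑.map (Finset.image Nat.cast), isCyclicDifferenceFamily_of_covers hg ?_ ?_ ?_⟩
  · simp only [Multiset.mem_map, forall_exists_index, and_imp, forall_apply_eq_imp_iff₂]
    intro B hB
    rw [card_image_natCast_zmod (hlt B hB)]
    exact hK B hB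
  · rw [Multiset.map_map, Multiset.map_congr rfl fun B hB => by
      rw [Function.comp_apply, card_image_natCast_zmod (hlt B hB)]]
    exact hcard
  · intro d hd
    obtain ⟨x, hx, hdx⟩ := exists_natCast_eq_or_neg_natCast_eq (show 0 < g * t by omega) d
    have hx_mem : (x : ZMod (g * t)) ∉ AddSubgroup.zmultiples (t : ZMod (g * t)) := by
      rcases hdx with rfl | rfl
      · exact hd
      · rwa [neg_mem_iff] at hd
    have ht_dvd : ¬ t ∣ x := by
      rintro ⟨i, rfl⟩
      rw [Nat.cast_mul, mul_comm (t : ZMod (g * t)), ← nsmul_eq_mul] at hx_mem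
      exact hx_mem (AddSubgroup.nsmul_mem_zmultiples _ i)
    have hx_bind := (hcov x hx ht_dvd).natCast_mem_bind_differenceList
      fun h => hx_mem (h ▸ zero_mem _)
    rcases hdx with rfl | rfl
    · exact hx_bind
    · exact neg_mem_bind_differenceList hx_bind

theorem exists_isCyclicDifferenceFamily_of_quintuples_of_triples {𝓠 𝓣 : Multiset (Finset ℕ)}
    (hQ : ∀ B ∈ 𝓠, B ∈ (Finset.range (4 * t)).powersetCard 5)
    (hT : ∀ B ∈ 𝓣, B ∈ (Finset.range (4 * t)).powersetCard 3)
    (hcard : 20 * 𝓠.card + 6 * 𝓣.card + 4 ≤ 4 * t)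
    (hcov : ∀ x, 0 < x → x < 2 * t → x ≠ t → HasDifference (4 * t) (𝓠 + 𝓣) x) :
    ∃ 𝓕 : Multiset (Finset (ZMod (4 * t))), IsCyclicDifferenceFamily 4 t {3, 5} 𝓕 := by
  simp only [Finset.mem_powersetCard] at hQ hT
  refine exists_isCyclicDifferenceFamily_of_hasDifference (𝓑 := 𝓠 + 𝓣) (by norm_num) ?_ ?_ ?_ ?_
  · intro B hB
    exact (Multiset.mem_add.1 hB).elim (fun h => (hQ B h).1) fun h => (hT B h).1
  · intro B hB
    exact (Multiset.mem_add.1 hB).elim (fun h => Or.inr (hQ B h).2) fun h => Or.inl (hT B h).2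
  · rw [Multiset.map_add, Multiset.sum_add,
      Multiset.map_congr rfl fun B hB => by rw [(hQ B hB).2],
      Multiset.map_congr (s := 𝓣) rfl fun B hB => by rw [(hT B hB).2]]
    simp only [Multiset.map_const', Multiset.sum_replicate, smul_eq_mul]
    omega
  · intro x hx ht_dvd
    have hne (i : ℕ) : x ≠ t * i := fun h => ht_dvd ⟨i, h⟩
    have h0 := hne 0
    have h1 := hne 1
    have h2 := hne 2
    exact hcov x (by omega) (by omega) (by omega)

end Representatives

section Blocks

theorem triple_mem_powersetCard_range {a b c v : ℕ} (hab : a < b) (hbc : b < c) (hcv : c < v) :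
    {a, b, c} ∈ (Finset.range v).powersetCard 3 := by
  refine Finset.mem_powersetCard.2 ⟨?_, Finset.card_eq_three.2
    ⟨a, b, c, hab.ne, (hab.trans hbc).ne, hbc.ne, rfl⟩⟩
  simp only [Finset.insert_subset_iff, Finset.singleton_subset_iff, Finset.mem_range]
  omega

theorem quintuple_mem_powersetCard_range {a b c d e v : ℕ} (hab : a < b) (hbc : b < c)
    (hcd : c < d) (hde : d < e) (hev : e < v) :
    {a, b, c, d, e} ∈ (Finset.range v).powersetCard 5 := by
  have hcard := (Finset.mem_powersetCard.1 (triple_mem_powersetCard_range hcd hde hev)).2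
  refine Finset.mem_powersetCard.2 ⟨?_, ?_⟩
  · simp only [Finset.insert_subset_iff, Finset.singleton_subset_iff, Finset.mem_range]
    omega
  · rw [Finset.card_insert_of_notMem (by simp; omega),
      Finset.card_insert_of_notMem (by simp; omega), hcard]

/-- The triples `{0, 2i + r, s + i}` for `a ≤ i < b`. Their differences are `2i + r`, `s + i`
and `s - r - i` up to sign; the intervals `[s - r - i, s + i]`, of length `2i + r`, are nested. -/
def nestedTriples (r s a b : ℕ) : Multiset (Finset ℕ) :=
  (Finset.Ico a b).val.map fun i => {0, 2 * i + r, s + i}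

variable {r s a b v x : ℕ}

theorem card_nestedTriples : (nestedTriples r s a b).card = b - a := by
  rw [nestedTriples, Multiset.card_map, Finset.card_val, Nat.card_Ico]

theorem mem_powersetCard_of_mem_nestedTriples (ha : 0 < 2 * a + r) (hs : b + r ≤ s)
    (hv : s + b ≤ v) : ∀ B ∈ nestedTriples r s a b, B ∈ (Finset.range v).powersetCard 3 := by
  simp only [nestedTriples, Multiset.mem_map, Finset.mem_val, Finset.mem_Ico]
  rintro _ ⟨i, ⟨hai, hib⟩, rfl⟩
  exact triple_mem_powersetCard_range (by omega) (by omega) (by omega)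

theorem hasDifference_nestedTriples
    (hx : (x % 2 = r % 2 ∧ 2 * a + r ≤ x ∧ x < 2 * b + r) ∨
      (s < x + r + b ∧ x + r + a ≤ s) ∨ (s + a ≤ x ∧ x < s + b)) :
    HasDifference v (nestedTriples r s a b) x := by
  have of_index (i : ℕ) (hi : a ≤ i ∧ i < b) (h : x = 2 * i + r ∨ x + r + i = s ∨ x = s + i) :
      HasDifference v (nestedTriples r s a b) x := by
    refine ⟨_, Multiset.mem_map_of_mem _ (Finset.mem_Ico.2 hi), ?_⟩
    rcases h with h | h | h
    · exact ⟨2 * i + r, by simp, 0, by simp, by omega⟩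
    · exact ⟨s + i, by simp, 2 * i + r, by simp, by omega⟩
    · exact ⟨s + i, by simp, 0, by simp, by omega⟩
  rcases hx with hx | hx | hx
  · exact of_index ((x - r) / 2) (by omega) (by omega)
  · exact of_index (s - r - x) (by omega) (by omega)
  · exact of_index (x - s) (by omega) (by omega)

end Blocks

section Constructions

theorem exists_isCyclicDifferenceFamily_of_nestedTriples {t s a b c d : ℕ}
    {𝓠 𝓢 : Multiset (Finset ℕ)}
    (hQ : ∀ B ∈ 𝓠, B ∈ (Finset.range (4 * t)).powersetCard 5)
    (hS : ∀ B ∈ 𝓢, B ∈ (Finset.range (4 * t)).powersetCard 3)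
    (ha : 0 < a) (hb : b ≤ t) (hd : d < s) (hs : s + d ≤ 4 * t)
    (hcard : 20 * 𝓠.card + 6 * (𝓢.card + (b - a) + (d - c)) + 4 ≤ 4 * t)
    (hcov : ∀ x, 0 < x → x < 2 * t → x ≠ t →
      HasDifference (4 * t) 𝓠 x ∨ HasDifference (4 * t) 𝓢 x ∨
        HasDifference (4 * t) (nestedTriples 0 t a b) x ∨
        HasDifference (4 * t) (nestedTriples 1 s c d) x) :
    ∃ 𝓕 : Multiset (Finset (ZMod (4 * t))), IsCyclicDifferenceFamily 4 t {3, 5} 𝓕 := by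
  refine exists_isCyclicDifferenceFamily_of_quintuples_of_triples
    (𝓣 := 𝓢 + (nestedTriples 0 t a b + nestedTriples 1 s c d)) hQ ?_ ?_ ?_
  · simp only [Multiset.mem_add, or_imp, forall_and]
    exact ⟨hS, mem_powersetCard_of_mem_nestedTriples (by omega) (by omega) (by omega),
      mem_powersetCard_of_mem_nestedTriples (by omega) (by omega) (by omega)⟩
  · simp only [Multiset.card_add, card_nestedTriples]
    omega
  · simpa only [hasDifference_add] using hcov

variable {k : ℕ}

theorem exists_isCyclicDifferenceFamily_six_mul_add_one :
    ∃ 𝓕 : Multiset (Finset (ZMod (4 * (6 * k + 1)))),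
      IsCyclicDifferenceFamily 4 (6 * k + 1) {3, 5} 𝓕 := by
  refine exists_isCyclicDifferenceFamily_of_nestedTriples (𝓠 := 0) (𝓢 := 0)
    (s := 10 * k + 2) (a := 1) (b := 2 * k + 1) (c := 0) (d := 2 * k) (by simp) (by simp)
    (by omega) (by omega) (by omega) (by omega) ?_ fun x h0 h2 h1 => Or.inr (Or.inr ?_)
  · simp only [Multiset.card_zero]
    omega
  · have hx : (x % 2 = 0 ∧ x ≤ 4 * k ∨ 4 * k < x ∧ x ≤ 8 * k + 1) ∨
        (x % 2 = 1 ∧ x < 4 * k ∨ 8 * k + 1 < x) := by omega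
    exact hx.imp (fun h => hasDifference_nestedTriples (by omega))
      fun h => hasDifference_nestedTriples (by omega)

theorem exists_isCyclicDifferenceFamily_six_mul_add_three (hk : 2 ≤ k) :
    ∃ 𝓕 : Multiset (Finset (ZMod (4 * (6 * k + 3)))),
      IsCyclicDifferenceFamily 4 (6 * k + 3) {3, 5} 𝓕 := by
  refine exists_isCyclicDifferenceFamily_of_nestedTriples
    (𝓠 := {{0, 1, 4 * k, 4 * k + 3, 14 * k + 7}})
    (𝓢 := {{0, 8 * k + 3, 16 * k + 7}, {0, 4 * k + 1, 12 * k + 7}})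
    (s := 10 * k + 6) (a := 1) (b := 2 * k) (c := 2) (d := 2 * k - 1) ?_ ?_
    (by omega) (by omega) (by omega) (by omega) ?_ fun x h0 h2 h1 => ?_
  · simp only [Multiset.mem_singleton, forall_eq]
    exact quintuple_mem_powersetCard_range (by omega) (by omega) (by omega) (by omega) (by omega)
  · simp only [Multiset.insert_eq_cons, Multiset.mem_cons, Multiset.mem_singleton,
      forall_eq_or_imp, forall_eq]
    exact ⟨triple_mem_powersetCard_range (by omega) (by omega) (by omega),
      triple_mem_powersetCard_range (by omega) (by omega) (by omega)⟩
  · simp only [Multiset.card_singleton, Multiset.card_pair]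
    omega
  · have hx : (x = 1 ∨ x = 3 ∨ x = 4 * k - 1 ∨ x = 4 * k ∨ x = 4 * k + 2 ∨ x = 4 * k + 3 ∨
          x = 10 * k + 4 ∨ x = 10 * k + 5 ∨ x = 10 * k + 6 ∨ x = 10 * k + 7) ∨
        (x = 4 * k + 1 ∨ x = 8 * k + 3 ∨ x = 8 * k + 4 ∨ x = 8 * k + 5 ∨ x = 8 * k + 6 ∨
          x = 12 * k + 5) ∨
        (x % 2 = 0 ∧ x < 4 * k ∨ 4 * k + 4 ≤ x ∧ x ≤ 8 * k + 2) ∨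
        (x % 2 = 1 ∧ 5 ≤ x ∧ x < 4 * k - 1 ∨ 8 * k + 7 ≤ x ∧ x ≤ 10 * k + 3 ∨
          10 * k + 8 ≤ x ∧ x ≤ 12 * k + 4) := by omega
    refine hx.imp (fun h => ?_) (Or.imp (fun h => ?_) (Or.imp
      (fun h => hasDifference_nestedTriples (by omega))
      fun h => hasDifference_nestedTriples (by omega)))
    all_goals
      simp only [HasDifference, Multiset.insert_eq_cons, Multiset.mem_cons, Multiset.mem_singleton,
        Finset.mem_insert, Finset.mem_singleton, exists_eq_or_imp, exists_eq_left]
      omega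

theorem exists_isCyclicDifferenceFamily_six_mul_add_five (hk : 2 ≤ k) :
    ∃ 𝓕 : Multiset (Finset (ZMod (4 * (6 * k + 5)))),
      IsCyclicDifferenceFamily 4 (6 * k + 5) {3, 5} 𝓕 := by
  refine exists_isCyclicDifferenceFamily_of_nestedTriples
    (𝓠 := {{0, 1, 4 * k, 4 * k + 3, 16 * k + 12},
      {0, 4 * k + 1, 8 * k + 6, 14 * k + 10, 18 * k + 14}})
    (𝓢 := {{0, 2, 8 * k + 7}})
    (s := 10 * k + 9) (a := 2) (b := 2 * k) (c := 2) (d := 2 * k - 1) ?_ ?_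
    (by omega) (by omega) (by omega) (by omega) ?_ fun x h0 h2 h1 => ?_
  · simp only [Multiset.insert_eq_cons, Multiset.mem_cons, Multiset.mem_singleton,
      forall_eq_or_imp, forall_eq]
    exact ⟨quintuple_mem_powersetCard_range (by omega) (by omega) (by omega) (by omega) (by omega),
      quintuple_mem_powersetCard_range (by omega) (by omega) (by omega) (by omega) (by omega)⟩
  · simp only [Multiset.mem_singleton, forall_eq]
    exact triple_mem_powersetCard_range (by omega) (by omega) (by omega)
  · simp only [Multiset.card_singleton, Multiset.card_pair]
    omega
  · have hx : ((x = 1 ∨ x = 3 ∨ x = 4 * k - 1 ∨ x = 4 * k ∨ x = 4 * k + 2 ∨ x = 4 * k + 3 ∨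
            x = 8 * k + 8 ∨ x = 8 * k + 9 ∨ x = 12 * k + 8 ∨ x = 12 * k + 9) ∨
          (x = 4 * k + 1 ∨ x = 4 * k + 4 ∨ x = 4 * k + 5 ∨ x = 6 * k + 4 ∨ x = 6 * k + 6 ∨
            x = 8 * k + 6 ∨ x = 10 * k + 7 ∨ x = 10 * k + 8 ∨ x = 10 * k + 9 ∨ x = 10 * k + 10)) ∨
        (x = 2 ∨ x = 8 * k + 5 ∨ x = 8 * k + 7) ∨
        (x % 2 = 0 ∧ 4 ≤ x ∧ x < 4 * k ∨ 4 * k + 6 ≤ x ∧ x ≤ 6 * k + 3 ∨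
          6 * k + 7 ≤ x ∧ x ≤ 8 * k + 4) ∨
        (x % 2 = 1 ∧ 5 ≤ x ∧ x < 4 * k - 1 ∨ 8 * k + 10 ≤ x ∧ x ≤ 10 * k + 6 ∨
          10 * k + 11 ≤ x ∧ x ≤ 12 * k + 7) := by omega
    refine hx.imp (fun h => ?_) (Or.imp (fun h => ?_) (Or.imp
      (fun h => hasDifference_nestedTriples (by omega))
      fun h => hasDifference_nestedTriples (by omega)))
    all_goals
      simp only [HasDifference, Multiset.insert_eq_cons, Multiset.mem_cons, Multiset.mem_singleton,
        Finset.mem_insert, Finset.mem_singleton, exists_eq_or_imp, exists_eq_left]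
      omega

theorem exists_isCyclicDifferenceFamily_nine :
    ∃ 𝓕 : Multiset (Finset (ZMod (4 * 9))), IsCyclicDifferenceFamily 4 9 {3, 5} 𝓕 := by
  refine exists_isCyclicDifferenceFamily_of_quintuples_of_triples
    (𝓠 := {{0, 1, 3, 8, 24}}) (𝓣 := {{0, 4, 14}, {0, 6, 17}}) ?_ ?_ (by simp) fun x h0 h2 h1 => ?_
  · simp only [Multiset.mem_singleton, forall_eq]
    exact quintuple_mem_powersetCard_range (by omega) (by omega) (by omega) (by omega) (by omega)
  · simp only [Multiset.insert_eq_cons, Multiset.mem_cons, Multiset.mem_singleton,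
      forall_eq_or_imp, forall_eq]
    exact ⟨triple_mem_powersetCard_range (by omega) (by omega) (by omega),
      triple_mem_powersetCard_range (by omega) (by omega) (by omega)⟩
  · simp only [HasDifference, Multiset.singleton_add, Multiset.insert_eq_cons, Multiset.mem_cons,
      Multiset.mem_singleton, Finset.mem_insert, Finset.mem_singleton, exists_eq_or_imp,
      exists_eq_left]
    interval_cases x <;> omega

end Constructions

theorem lemma4p15 (t : ℕ) (ht_odd : Odd t) (ht_ge : 7 ≤ t) (ht_ne : t ≠ 11) :
    ∃ 𝓕 : Multiset (Finset (ZMod (4 * t))), IsCyclicDifferenceFamily 4 t {3, 5} 𝓕 := by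
  have hmod : t % 6 = 1 ∨ t % 6 = 3 ∨ t % 6 = 5 := by
    obtain ⟨m, rfl⟩ := ht_odd
    omega
  rcases hmod with h | h | h
  · obtain ⟨k, rfl⟩ : ∃ k, t = 6 * k + 1 := ⟨t / 6, by omega⟩
    exact exists_isCyclicDifferenceFamily_six_mul_add_one
  · obtain ⟨k, rfl⟩ : ∃ k, t = 6 * k + 3 := ⟨t / 6, by omega⟩
    obtain rfl | hk : k = 1 ∨ 2 ≤ k := by omega
    · exact exists_isCyclicDifferenceFamily_nine
    · exact exists_isCyclicDifferenceFamily_six_mul_add_three hk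
  · obtain ⟨k, rfl⟩ : ∃ k, t = 6 * k + 5 := ⟨t / 6, by omega⟩
    exact exists_isCyclicDifferenceFamily_six_mul_add_five (by omega)
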